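/- A tournament $T$ is a finite digraph in which each pair of distinct vertices is joined by precisely one arc (and there are no loops). Its irregularity $i(T)$ is the maximum of $|d^{+}(x)-d^{-}(x)|$ over all vertices $x$ of $T$, where $d^{+}(x)$ and $d^{-}(x)$ are the out-degree and the in-degree of $x$. For $\omega\ge 1$ and distinct vertices $u,v$, a weak $\omega^{*}$-container between $u$ and $v$ is a set of $\omega$ distinct, internally disjoint directed paths, each of which is either a $(u,v)$-path or a $(v,u)$-path (both directions may occur in the same set), that together contain all vertices of $T$. The tournament $T$ is $\omega^{*}$-weakly connected if there is a weak $\omega^{*}$-container between any two distinct vertices of $T$. The weak spanning connectivity $\kappa_{w}^{*}(T)$ is the largest integer $m$ such that $T$ is $\omega^{*}$-weakly connected for all $1\le\omega\le m$. Theorem. Let $t\ge 2$ and $k\ge 0$ be integers and let $T$ be a tournament on $n$ vertices with $i(T)\le k$. If $n\ge 6t+5k-3$, then $\kappa_{w}^{*}(T)\ge t+1$. -/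

import Mathlib

namespace Digraph

variable {V : Type*}

/-- A tournament: a loopless digraph in which each pair of distinct vertices is joined by precisely
one arc. -/
structure IsTournament (T : Digraph V) : Prop where
  irrefl : ∀ v, ¬ T.Adj v v
  existsArc : ∀ u v, u ≠ v → T.Adj u v ∨ T.Adj v u
  uniqueArc : ∀ u v, T.Adj u v → ¬ T.Adj v u

/-- The out-degree of `v`: the number of vertices dominated by `v`. -/
noncomputable def outDeg (D : Digraph V) (v : V) : ℕ := {w | D.Adj v w}.ncard

/-- The in-degree of `v`: the number of vertices that dominate `v`. -/
noncomputable def inDeg (D : Digraph V) (v : V) : ℕ := {w | D.Adj w v}.ncard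

/-- The irregularity `i(D)`: the maximum of `|d⁺(v) - d⁻(v)|` over all vertices `v`. -/
noncomputable def irregularity [Fintype V] (D : Digraph V) : ℕ :=
  Finset.univ.sup fun v => ((D.outDeg v : ℤ) - (D.inDeg v : ℤ)).natAbs

/-- `p` is the vertex sequence of a (directed) `(u, v)`-path of `D`. -/
structure IsPath (D : Digraph V) (u v : V) (p : List V) : Prop where
  chain : p.IsChain D.Adj
  nodup : p.Nodup
  head : p.head? = some u
  last : p.getLast? = some v

/-- `C` is a weak `k`-container between `u` and `v` that spans `D`: a set of `k` (distinct)
internally disjoint paths between `u` and `v`, each of which is directed either from `u` to `v` or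
from `v` to `u`, that together contain all vertices of `D`. -/
structure IsWeakSpanningContainer (D : Digraph V) (k : ℕ) (u v : V) (C : Finset (List V)) :
    Prop where
  card : C.card = k
  path : ∀ p ∈ C, D.IsPath u v p ∨ D.IsPath v u p
  internallyDisjoint : ∀ p ∈ C, ∀ q ∈ C, p ≠ q → ∀ w, w ∈ p → w ∈ q → w = u ∨ w = v
  spanning : ∀ w, ∃ p ∈ C, w ∈ p

/-- `D` is `k*`-weakly connected: there is a weak spanning `k`-container between any two distinct
vertices. -/
def WeaklySpanningConnected (D : Digraph V) (k : ℕ) : Prop :=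
  ∀ u v, u ≠ v → ∃ C : Finset (List V), D.IsWeakSpanningContainer k u v C

/-- The weak spanning connectivity: the largest `k` such that `D` is `ω*`-weakly connected for all
`1 ≤ ω ≤ k`. By `bddAbove_weaklySpanningConnected` there is a largest such `k` when `D` is finite
and has at least two vertices; it is `0` when `D` is not `1*`-weakly connected. -/
noncomputable def weakSpanningConnectivity (D : Digraph V) : ℕ :=
  sSup {k | ∀ ω, 1 ≤ ω → ω ≤ k → D.WeaklySpanningConnected ω}

theorem bddAbove_weaklySpanningConnected [Fintype V] [Nontrivial V] (D : Digraph V) :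
    BddAbove {k | ∀ ω, 1 ≤ ω → ω ≤ k → D.WeaklySpanningConnected ω} := by
  classical
  obtain ⟨u, v, huv⟩ := exists_pair_ne V
  refine ⟨Fintype.card {l : List V // l.Nodup}, fun k hk => ?_⟩
  rcases Nat.eq_zero_or_pos k with rfl | hpos
  · exact Nat.zero_le _
  obtain ⟨C, hC⟩ := hk k hpos le_rfl u v huv
  have hnd : ∀ p ∈ C, p.Nodup := fun p hp => (hC.path p hp).elim (·.nodup) (·.nodup)
  rw [← hC.card, ← Fintype.card_coe]
  exact Fintype.card_le_of_injective
    (fun p : C => (⟨p.1, hnd p.1 p.2⟩ : {l : List V // l.Nodup}))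
    (fun p q h => Subtype.ext (Subtype.mk.inj h))

end Digraph

/-! In a tournament of irregularity at most `k` all in- and out-degrees lie within `k / 2` of `(n -
1) / 2`. So a nonempty set `X` whose out-neighbours (or in-neighbours) all lie in `X ∪ Z` satisfies
`n ≤ |X| + 2|Z| + k`; this count drives nearly every step.

For `ω = m + 1 ≥ 3`, choose `m` disjoint cores, that is, interiors with one or two vertices of paths
between `u` and `v`, with both directions represented (`exists_isCoreFamily`). Uncovered vertices
are then absorbed into these paths (`PathSystem.exists_spanning`): a vertex, or a pair, that fits
nowhere would produce a closed set that is too small. The arc joining `u` and `v` is the last path;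
it is new because every other path has an internal vertex.

For `ω = 1, 2` a spanning path in one of the two directions is enough, again with the arc added for
`ω = 2`. By Camion's theorem `T - {u, v}` has a Hamiltonian cycle. If no way of opening it extends
to a spanning path, the types `u → z → v` and `v → z → u` alternate along the cycle, and two chords
allow it to be rerouted into a spanning path after all (`false_of_no_spanning_path`). -/

namespace Digraph

/-! ### Degrees and closed sets under bounded irregularity. -/

open Finset in
theorem IsTournament.outDeg_add_inDeg {V : Type*} [Fintype V] {T : Digraph V}
    (hT : T.IsTournament) (v : V) : T.outDeg v + T.inDeg v + 1 = Fintype.card V := by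
  classical
  have h1 : T.outDeg v = #{w | T.Adj v w} := by
    rw [outDeg, ← Set.ncard_coe_finset]; simp
  have h2 : T.inDeg v = #{w | T.Adj w v} := by
    rw [inDeg, ← Set.ncard_coe_finset]; simp
  have h3 : Disjoint ({w | T.Adj v w} : Finset V) ({w | T.Adj w v} : Finset V) := by
    rw [Finset.disjoint_left]
    intro w hw hw'
    simp only [mem_filter, mem_univ, true_and] at hw hw'
    exact hT.uniqueArc _ _ hw hw'
  have h4 : ({w | T.Adj v w} : Finset V) ∪ ({w | T.Adj w v} : Finset V) = univ.erase v := by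
    ext w
    simp only [mem_union, mem_filter, mem_univ, true_and, mem_erase, and_true]
    constructor
    · rintro h rfl
      rcases h with h | h <;> exact hT.irrefl _ h
    · intro h
      exact hT.existsArc _ _ (Ne.symm h)
  rw [h1, h2, ← card_union_of_disjoint h3, h4, card_erase_of_mem (mem_univ _), card_univ]
  have : 0 < Fintype.card V := Fintype.card_pos_iff.2 ⟨v⟩
  omega

theorem natAbs_outDeg_sub_inDeg_le {V : Type*} [Fintype V] (T : Digraph V) (v : V) :
    ((T.outDeg v : ℤ) - (T.inDeg v : ℤ)).natAbs ≤ T.irregularity :=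
  Finset.le_sup (f := fun v => ((T.outDeg v : ℤ) - (T.inDeg v : ℤ)).natAbs) (Finset.mem_univ v)

theorem IsTournament.card_le_outDeg {V : Type*} [Fintype V] {T : Digraph V}
    (hT : T.IsTournament) {k : ℕ} (hk : T.irregularity ≤ k) (v : V) :
    Fintype.card V ≤ 2 * T.outDeg v + k + 1 := by
  have h1 := hT.outDeg_add_inDeg v
  have h2 := T.natAbs_outDeg_sub_inDeg_le v
  omega

theorem IsTournament.card_le_inDeg {V : Type*} [Fintype V] {T : Digraph V}
    (hT : T.IsTournament) {k : ℕ} (hk : T.irregularity ≤ k) (v : V) :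
    Fintype.card V ≤ 2 * T.inDeg v + k + 1 := by
  have h1 := hT.outDeg_add_inDeg v
  have h2 := T.natAbs_outDeg_sub_inDeg_le v
  omega

theorem outDeg_le_card {V : Type*} (T : Digraph V) (v : V) (s : Finset V)
    (h : ∀ w, T.Adj v w → w ∈ s) : T.outDeg v ≤ s.card := by
  rw [outDeg, ← Set.ncard_coe_finset]
  exact Set.ncard_le_ncard (fun w hw => h w hw) s.finite_toSet

theorem inDeg_le_card {V : Type*} (T : Digraph V) (v : V) (s : Finset V)
    (h : ∀ w, T.Adj w v → w ∈ s) : T.inDeg v ≤ s.card := by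
  rw [inDeg, ← Set.ncard_coe_finset]
  exact Set.ncard_le_ncard (fun w hw => h w hw) s.finite_toSet

theorem card_le_outDeg_of_forall {V : Type*} [Finite V] (T : Digraph V) (v : V) (s : Finset V)
    (h : ∀ w ∈ s, T.Adj v w) : s.card ≤ T.outDeg v := by
  rw [outDeg, ← Set.ncard_coe_finset]
  exact Set.ncard_le_ncard (fun w hw => h w hw) (Set.toFinite _)

theorem card_le_inDeg_of_forall {V : Type*} [Finite V] (T : Digraph V) (v : V) (s : Finset V)
    (h : ∀ w ∈ s, T.Adj w v) : s.card ≤ T.inDeg v := by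
  rw [inDeg, ← Set.ncard_coe_finset]
  exact Set.ncard_le_ncard (fun w hw => h w hw) (Set.toFinite _)

open Finset Classical in
theorem IsTournament.card_filter_add_card_filter {V : Type*} {T : Digraph V}
    (hT : T.IsTournament) (X : Finset V) {x : V} (hx : x ∈ X) :
    #{w ∈ X | T.Adj x w} + #{w ∈ X | T.Adj w x} + 1 = #X := by
  have h3 : Disjoint ({w ∈ X | T.Adj x w} : Finset V) ({w ∈ X | T.Adj w x} : Finset V) := by
    rw [Finset.disjoint_left]
    intro w hw hw'
    exact hT.uniqueArc _ _ (mem_filter.1 hw).2 (mem_filter.1 hw').2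
  have h4 : ({w ∈ X | T.Adj x w} : Finset V) ∪ ({w ∈ X | T.Adj w x} : Finset V) = X.erase x := by
    ext w
    simp only [mem_union, mem_filter, mem_erase]
    constructor
    · rintro (h | h)
      · exact ⟨fun e => hT.irrefl x (e ▸ h.2), h.1⟩
      · exact ⟨fun e => hT.irrefl x (e ▸ h.2), h.1⟩
    · intro h
      exact (hT.existsArc x w (Ne.symm h.1)).imp (⟨h.2, ·⟩) (⟨h.2, ·⟩)
  rw [← card_union_of_disjoint h3, h4, card_erase_of_mem hx]
  have : 0 < #X := card_pos.2 ⟨x, hx⟩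
  omega

open Finset Classical in
theorem sum_card_filter_adj_comm {V : Type*} (T : Digraph V) (X : Finset V) :
    ∑ x ∈ X, #{w ∈ X | T.Adj x w} = ∑ x ∈ X, #{w ∈ X | T.Adj w x} :=
  sum_card_bipartiteAbove_eq_sum_card_bipartiteBelow _

open Finset Classical in
-- By averaging, some `x ∈ X` has at most `(|X| - 1) / 2` out-neighbours inside `X`, hence
-- out-degree at most that plus `|Z|`, while the irregularity forces out-degree at least `(n - k -
-- 1) / 2`.
theorem IsTournament.card_le_of_out_closed {V : Type*} [Fintype V] {T : Digraph V}
    (hT : T.IsTournament) {k : ℕ} (hk : T.irregularity ≤ k) {X Z : Finset V} (hX : X.Nonempty)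
    (h : ∀ x ∈ X, ∀ y, T.Adj x y → y ∈ X ∨ y ∈ Z) : Fintype.card V ≤ #X + 2 * #Z + k := by
  obtain ⟨x, hx, hle⟩ := exists_le_of_sum_le hX (T.sum_card_filter_adj_comm X).le
  have h1 := hT.card_filter_add_card_filter X hx
  have h2 := hT.card_le_outDeg hk x
  have h3 := T.outDeg_le_card x ({w ∈ X | T.Adj x w} ∪ Z) fun w hw => by
    simpa [hw] using h x hx w hw
  have h4 := card_union_le ({w ∈ X | T.Adj x w}) Z
  omega

open Finset Classical in
theorem IsTournament.card_le_of_in_closed {V : Type*} [Fintype V] {T : Digraph V}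
    (hT : T.IsTournament) {k : ℕ} (hk : T.irregularity ≤ k) {X Z : Finset V} (hX : X.Nonempty)
    (h : ∀ x ∈ X, ∀ y, T.Adj y x → y ∈ X ∨ y ∈ Z) : Fintype.card V ≤ #X + 2 * #Z + k := by
  obtain ⟨x, hx, hle⟩ := exists_le_of_sum_le hX (T.sum_card_filter_adj_comm X).ge
  have h1 := hT.card_filter_add_card_filter X hx
  have h2 := hT.card_le_inDeg hk x
  have h3 := T.inDeg_le_card x ({w ∈ X | T.Adj w x} ∪ Z) fun w hw => by
    simpa [hw] using h x hx w hw
  have h4 := card_union_le ({w ∈ X | T.Adj w x}) Z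
  omega

theorem IsTournament.adj_of_not_adj {V : Type*} {T : Digraph V} (hT : T.IsTournament) {x y : V}
    (hne : x ≠ y) (h : ¬ T.Adj x y) : T.Adj y x :=
  (hT.existsArc x y hne).resolve_left h

end Digraph

/-! ### Inserting vertices into paths. -/

namespace List

theorem exists_split_of_head {α : Type*} {P : α → Prop} {x z : α} {l : List α} (hx : P x)
    (hz : z ∈ l) (hz' : ¬ P z) :
    ∃ l₁ a b l₂, x :: l = l₁ ++ a :: b :: l₂ ∧ P a ∧ ¬ P b := by
  induction l generalizing x with
  | nil => simp at hz
  | cons y l ih =>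
    by_cases hy : P y
    · have hzl : z ∈ l := by
        rcases mem_cons.1 hz with rfl | h
        · exact absurd hy hz'
        · exact h
      obtain ⟨l₁, a, b, l₂, h, ha, hb⟩ := ih hy hzl
      exact ⟨x :: l₁, a, b, l₂, by simp [h], ha, hb⟩
    · exact ⟨[], x, y, l, rfl, hx, hy⟩

theorem IsChain.insert {α : Type*} {R : α → α → Prop} {l₁ l₂ : List α} {a b w : α}
    (h : IsChain R (l₁ ++ a :: b :: l₂)) (ha : R a w) (hb : R w b) :
    IsChain R (l₁ ++ a :: w :: b :: l₂) := by
  simp only [isChain_append_cons_cons, isChain_cons_cons] at h ⊢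
  exact ⟨h.1, ha, hb, h.2.2⟩

end List

namespace Digraph

/-- A vertex `w` can be inserted between consecutive vertices `a`, `b` of a path if `a` dominates
`w` and `w` dominates `b`. -/
theorem IsPath.exists_insert_of_split {V : Type*} {T : Digraph V} {s e w : V} {p : List V}
    (hp : T.IsPath s e p) (hw : w ∉ p)
    (h : ∃ l₁ a b l₂, p = l₁ ++ a :: b :: l₂ ∧ T.Adj a w ∧ T.Adj w b) :
    ∃ q, T.IsPath s e q ∧ ∀ x, x ∈ q ↔ x ∈ p ∨ x = w := by
  obtain ⟨l₁, a, b, l₂, rfl, ha, hb⟩ := h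
  refine ⟨l₁ ++ a :: w :: b :: l₂, ⟨hp.chain.insert ha hb, ?_, ?_, ?_⟩, fun x => ?_⟩
  · have := hp.nodup
    have hperm : (l₁ ++ a :: w :: b :: l₂).Perm (w :: (l₁ ++ a :: b :: l₂)) := by
      have := List.perm_middle (a := w) (l₁ := l₁ ++ [a]) (l₂ := b :: l₂)
      simpa using this
    rw [hperm.nodup_iff]
    exact List.nodup_cons.2 ⟨hw, this⟩
  · have := hp.head
    cases l₁ <;> simpa using this
  · have := hp.last
    simpa using this
  · simp only [List.mem_append, List.mem_cons]
    tauto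

/-- Between `x`, which dominates `w`, and the later vertex `y`, which does not, domination of `w`
must stop at some consecutive pair; `w` fits there. -/
theorem IsTournament.exists_insert {V : Type*} {T : Digraph V} (hT : T.IsTournament)
    {s e w x y : V} {l p : List V} (hp : T.IsPath s e p) (hw : w ∉ p)
    (hsuf : x :: l <:+ p) (hx : T.Adj x w) (hy : y ∈ l) (hwy : T.Adj w y) :
    ∃ q, T.IsPath s e q ∧ ∀ z, z ∈ q ↔ z ∈ p ∨ z = w := by
  obtain ⟨l₀, rfl⟩ := hsuf
  obtain ⟨l₁, a, b, l₂, h, ha, hb⟩ :=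
    List.exists_split_of_head (P := fun z => T.Adj z w) hx hy (hT.uniqueArc _ _ hwy)
  refine hp.exists_insert_of_split hw ⟨l₀ ++ l₁, a, b, l₂, by simp [h], ha,
    hT.adj_of_not_adj ?_ hb⟩
  rintro rfl
  exact hw (by simp [h])

theorem IsPath.exists_cons {V : Type*} {T : Digraph V} {s e : V} {p : List V}
    (hp : T.IsPath s e p) : ∃ l, p = s :: l := by
  have := hp.head
  cases p with
  | nil => simp at this
  | cons a l => exact ⟨l, by simpa using this⟩

theorem IsPath.last_mem {V : Type*} {T : Digraph V} {s e : V} {p : List V}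
    (hp : T.IsPath s e p) : e ∈ p := List.mem_of_getLast? hp.last

theorem IsPath.head_mem {V : Type*} {T : Digraph V} {s e : V} {p : List V}
    (hp : T.IsPath s e p) : s ∈ p := List.mem_of_head? hp.head

theorem IsTournament.exists_insert_of_head {V : Type*} {T : Digraph V} (hT : T.IsTournament)
    {s e w y : V} {p : List V} (hp : T.IsPath s e p) (hw : w ∉ p) (hs : T.Adj s w)
    (hy : y ∈ p) (hwy : T.Adj w y) :
    ∃ q, T.IsPath s e q ∧ ∀ z, z ∈ q ↔ z ∈ p ∨ z = w := by
  obtain ⟨l, rfl⟩ := hp.exists_cons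
  refine hT.exists_insert hp hw List.suffix_rfl hs (y := y) ?_ hwy
  rcases List.mem_cons.1 hy with rfl | h
  · exact absurd hwy (hT.uniqueArc _ _ hs)
  · exact h

theorem IsTournament.exists_insert_of_last {V : Type*} {T : Digraph V} (hT : T.IsTournament)
    {s e w x : V} {p : List V} (hp : T.IsPath s e p) (hw : w ∉ p) (he : T.Adj w e)
    (hx : x ∈ p) (hxw : T.Adj x w) :
    ∃ q, T.IsPath s e q ∧ ∀ z, z ∈ q ↔ z ∈ p ∨ z = w := by
  obtain ⟨l₁, l₂, rfl⟩ := List.append_of_mem hx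
  have hl : e ∈ x :: l₂ := by
    have := hp.last
    rw [List.getLast?_append_of_ne_nil _ (by simp)] at this
    exact List.mem_of_getLast? this
  refine hT.exists_insert hp hw (List.suffix_append l₁ (x :: l₂)) hxw (y := e) ?_ he
  rcases List.mem_cons.1 hl with rfl | h
  · exact absurd he (hT.uniqueArc _ _ hxw)
  · exact h

theorem IsPath.exists_insert_pair {V : Type*} {T : Digraph V}
    {s e c d : V} {p : List V} (hse : s ≠ e) (hp : T.IsPath s e p) (hc : c ∉ p) (hd : d ∉ p)
    (hne : c ≠ d) (hcd : T.Adj c d) (hpc : T.Adj s c) (hdp : ∀ x ∈ p, T.Adj d x) :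
    ∃ q, T.IsPath s e q ∧ ∀ z, z ∈ q ↔ z ∈ p ∨ z = c ∨ z = d := by
  obtain ⟨l, rfl⟩ := hp.exists_cons
  cases l with
  | nil => exact absurd (by simpa using hp.last) hse
  | cons b l =>
    refine ⟨s :: c :: d :: b :: l, ⟨?_, ?_, ?_, ?_⟩, fun z => ?_⟩
    · have := hp.chain
      simp only [List.isChain_cons_cons] at this ⊢
      exact ⟨hpc, hcd, hdp b (by simp), this.2⟩
    · have := hp.nodup
      simp only [List.nodup_cons, List.mem_cons, not_or] at *
      grind
    · simp
    · simpa using hp.last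
    · simp only [List.mem_cons]; tauto

/-! ### Extending path systems until they span. -/

/-- A family of paths of `T`, the `i`-th one from `s i` to `e i`, any two of which meet at most in
`u` and `v`. -/
structure PathSystem {V ι : Type*} (T : Digraph V) (u v : V) (s e : ι → V) (f : ι → List V) :
    Prop where
  path : ∀ i, T.IsPath (s i) (e i) (f i)
  disjoint : ∀ i j, i ≠ j → ∀ w, w ∈ f i → w ∈ f j → w = u ∨ w = v

theorem PathSystem.exists_extend {V ι : Type*} {T : Digraph V} {u v : V}
    {s e : ι → V} {f : ι → List V} (hf : T.PathSystem u v s e f) {S : Set V} (hS : S.Nonempty)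
    (hSf : ∀ w ∈ S, ∀ j, w ∉ f j) (i : ι)
    (h : ∃ q, T.IsPath (s i) (e i) q ∧ ∀ z, z ∈ q ↔ z ∈ f i ∨ z ∈ S) :
    ∃ g, T.PathSystem u v s e g ∧ (∀ j w, w ∈ f j → w ∈ g j) ∧
      ∃ w, (∃ j, w ∈ g j) ∧ ∀ j, w ∉ f j := by
  classical
  obtain ⟨q, hq, hz⟩ := h
  obtain ⟨w, hw⟩ := hS
  refine ⟨Function.update f i q, ⟨fun j => ?_, fun j l hjl x hj hl => ?_⟩, fun j x hx => ?_,
    w, ⟨i, by simp [hz, hw]⟩, hSf w hw⟩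
  · rcases eq_or_ne j i with rfl | hj
    · simpa using hq
    · simpa [hj] using hf.path j
  · rcases eq_or_ne j i with rfl | hji
    · rw [Function.update_self] at hj
      rw [Function.update_of_ne hjl.symm] at hl
      rcases (hz x).1 hj with h | h
      · exact hf.disjoint _ _ hjl x h hl
      · exact absurd hl (hSf x h l)
    · rw [Function.update_of_ne hji] at hj
      rcases eq_or_ne l i with rfl | hli
      · rw [Function.update_self] at hl
        rcases (hz x).1 hl with h | h
        · exact hf.disjoint _ _ hjl x hj h
        · exact absurd hj (hSf x h j)
      · rw [Function.update_of_ne hli] at hl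
        exact hf.disjoint _ _ hjl x hj hl
  · rcases eq_or_ne j i with rfl | hj
    · simp [hz, hx]
    · simpa [hj] using hx

/-- If no insertion is possible, having a path in each direction forces every uncovered vertex
either to be dominated by all path vertices or to dominate them all. No arc goes from the first kind
to the second, so each kind is closed in one direction. -/
theorem PathSystem.exists_extend_of_not_spanning {V ι : Type*} [Fintype V] {T : Digraph V}
    (hT : T.IsTournament) {k : ℕ} (hk : T.irregularity ≤ k) (hn : 3 * k ≤ Fintype.card V)
    {u v : V} (huv : u ≠ v) {s e : ι → V} {f : ι → List V} (hf : T.PathSystem u v s e f)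
    (hse : ∀ i, (s i = u ∧ e i = v) ∨ (s i = v ∧ e i = u))
    {i₀ i₁ : ι} (h₀ : s i₀ = u ∧ e i₀ = v) (h₁ : s i₁ = v ∧ e i₁ = u)
    {w : V} (hw : ∀ i, w ∉ f i) :
    ∃ g, T.PathSystem u v s e g ∧ (∀ j w, w ∈ f j → w ∈ g j) ∧
      ∃ w, (∃ j, w ∈ g j) ∧ ∀ j, w ∉ f j := by
  classical
  by_contra hno
  have key : ∀ i x, (∀ j, x ∉ f j) →
      ¬ ∃ q, T.IsPath (s i) (e i) q ∧ ∀ z, z ∈ q ↔ z ∈ f i ∨ z = x := fun i x hx h =>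
    hno (hf.exists_extend (S := {x}) ⟨x, rfl⟩ (by simpa using hx) i (by simpa using h))
  have hu : ∀ x, (∀ j, x ∉ f j) → x ≠ u := by
    rintro x hx rfl
    exact hx i₀ (h₀.1 ▸ (hf.path i₀).head_mem)
  have hv : ∀ x, (∀ j, x ∉ f j) → x ≠ v := by
    rintro x hx rfl
    exact hx i₁ (h₁.1 ▸ (hf.path i₁).head_mem)
  have hse' : ∀ i, s i ≠ e i := by
    intro i
    rcases hse i with h | h <;> rw [h.1, h.2]
    exacts [huv, huv.symm]
  have hA : ∀ x, (∀ j, x ∉ f j) → T.Adj u x → ¬ T.Adj x v := fun x hx hux hxv =>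
    key i₀ x hx (hT.exists_insert_of_head (hf.path i₀) (hx i₀) (h₀.1 ▸ hux)
      (hf.path i₀).last_mem (h₀.2 ▸ hxv))
  have hB : ∀ x, (∀ j, x ∉ f j) → T.Adj v x → ¬ T.Adj x u := fun x hx hux hxv =>
    key i₁ x hx (hT.exists_insert_of_head (hf.path i₁) (hx i₁) (h₁.1 ▸ hux)
      (hf.path i₁).last_mem (h₁.2 ▸ hxv))
  have hCD : ∀ x, (∀ j, x ∉ f j) → (T.Adj u x ∧ T.Adj v x) ∨ (T.Adj x u ∧ T.Adj x v) := by
    intro x hx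
    have h1 := hT.existsArc u x (hu x hx).symm
    have h2 := hT.existsArc v x (hv x hx).symm
    have h3 := hA x hx
    have h4 := hB x hx
    tauto
  have hC : ∀ x, (∀ j, x ∉ f j) → T.Adj u x → ∀ j, ∀ y ∈ f j, T.Adj y x := by
    intro x hx hux j y hy
    refine hT.adj_of_not_adj (fun h => hx j (h ▸ hy)) fun hxy => ?_
    have hvx : T.Adj v x := by
      rcases hCD x hx with h | h
      · exact h.2
      · exact absurd h.1 (hT.uniqueArc _ _ hux)
    refine key j x hx (hT.exists_insert_of_head (hf.path j) (hx j) ?_ hy hxy)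
    rcases hse j with h | h <;> rw [h.1] <;> assumption
  have hD : ∀ x, (∀ j, x ∉ f j) → T.Adj x u → ∀ j, ∀ y ∈ f j, T.Adj x y := by
    intro x hx hxu j y hy
    refine hT.adj_of_not_adj (fun h => hx j (h ▸ hy)) fun hyx => ?_
    have hxv : T.Adj x v := by
      rcases hCD x hx with h | h
      · exact absurd h.1 (hT.uniqueArc _ _ hxu)
      · exact h.2
    refine key j x hx (hT.exists_insert_of_last (hf.path j) (hx j) ?_ hy hyx)
    rcases hse j with h | h <;> rw [h.2] <;> assumption
  have hcd : ∀ c d, (∀ j, c ∉ f j) → (∀ j, d ∉ f j) → T.Adj u c → T.Adj d u → ¬ T.Adj c d := by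
    intro c d hc hd huc hdu hadj
    -- Such an arc `c → d` would fit right after the start of the path `i₀`, since `d` dominates the
    -- whole path.
    refine hno (hf.exists_extend (S := {c, d}) ⟨c, by simp⟩ ?_ i₀ ?_)
    · rintro x (rfl | rfl) <;> assumption
    · exact (hf.path i₀).exists_insert_pair (hse' i₀) (hc i₀) (hd i₀)
        (fun h => hT.irrefl c (by rwa [← h] at hadj)) hadj (h₀.1 ▸ huc) (hD d hd hdu i₀)
  rcases hCD w hw with hwC | hwD
  · have h1 := hT.card_le_of_out_closed hk (X := {x | (∀ j, x ∉ f j) ∧ T.Adj u x}) (Z := ∅)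
      ⟨w, by simp [hw, hwC.1]⟩ (fun x hx y hxy => ?_)
    · have h2 := T.card_le_outDeg_of_forall u {x | (∀ j, x ∉ f j) ∧ T.Adj u x} (by simp)
      have h3 := hT.outDeg_add_inDeg u
      have h4 := hT.card_le_inDeg hk u
      rw [Finset.card_empty] at h1
      omega
    · simp only [Finset.mem_filter, Finset.mem_univ, true_and] at hx
      have hy : ∀ j, y ∉ f j := fun j hj => hT.uniqueArc _ _ hxy (hC x hx.1 hx.2 j y hj)
      left
      simp only [Finset.mem_filter, Finset.mem_univ, true_and]
      exact ⟨hy, hT.adj_of_not_adj (hu y hy) fun h => hcd x y hx.1 hy hx.2 h hxy⟩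
  · have h1 := hT.card_le_of_in_closed hk (X := {x | (∀ j, x ∉ f j) ∧ T.Adj x u}) (Z := ∅)
      ⟨w, by simp [hw, hwD.1]⟩ (fun x hx y hxy => ?_)
    · have h2 := T.card_le_inDeg_of_forall u {x | (∀ j, x ∉ f j) ∧ T.Adj x u} (by simp)
      have h3 := hT.outDeg_add_inDeg u
      have h4 := hT.card_le_outDeg hk u
      rw [Finset.card_empty] at h1
      omega
    · simp only [Finset.mem_filter, Finset.mem_univ, true_and] at hx
      have hy : ∀ j, y ∉ f j := fun j hj => hT.uniqueArc _ _ hxy (hD x hx.1 hx.2 j y hj)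
      left
      simp only [Finset.mem_filter, Finset.mem_univ, true_and]
      exact ⟨hy, hT.adj_of_not_adj (hu y hy).symm fun h => hcd y x hy hx.1 h hx.2 hxy⟩

theorem PathSystem.exists_spanning {V ι : Type*} [Fintype V] {T : Digraph V}
    (hT : T.IsTournament) {k : ℕ} (hk : T.irregularity ≤ k) (hn : 3 * k ≤ Fintype.card V)
    {u v : V} (huv : u ≠ v) {s e : ι → V}
    (hse : ∀ i, (s i = u ∧ e i = v) ∨ (s i = v ∧ e i = u))
    {i₀ i₁ : ι} (h₀ : s i₀ = u ∧ e i₀ = v) (h₁ : s i₁ = v ∧ e i₁ = u)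
    {f : ι → List V} (hf : T.PathSystem u v s e f) :
    ∃ g, T.PathSystem u v s e g ∧ (∀ j w, w ∈ f j → w ∈ g j) ∧ ∀ w, ∃ i, w ∈ g i := by
  classical
  induction hN : Finset.card {w | ∀ i, w ∉ f i} using Nat.strong_induction_on generalizing f with
  | _ N ih =>
    by_cases hsp : ∀ w, ∃ i, w ∈ f i
    · exact ⟨f, hf, fun _ _ h => h, hsp⟩
    · push Not at hsp
      obtain ⟨w, hw⟩ := hsp
      obtain ⟨g, hg, hfg, x, ⟨j, hxj⟩, hx⟩ :=
        hf.exists_extend_of_not_spanning hT hk hn huv hse h₀ h₁ hw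
      have hlt : Finset.card {w | ∀ i, w ∉ g i} < N := by
        rw [← hN]
        refine Finset.card_lt_card ((Finset.ssubset_iff_of_subset ?_).2 ⟨x, ?_, ?_⟩)
        · intro y hy
          simp only [Finset.mem_filter, Finset.mem_univ, true_and] at hy ⊢
          exact fun i hi => hy i (hfg i y hi)
        · simpa using hx
        · simpa using ⟨j, hxj⟩
      obtain ⟨g', hg', hgg', hsp⟩ := ih _ hlt hg rfl
      exact ⟨g', hg', fun j w h => hgg' j w (hfg j w h), hsp⟩

/-- A spanning path system all of whose paths have an internal vertex gives weak spanning
containers with as many paths, and with one path more. -/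
theorem PathSystem.exists_containers {V ι : Type*} [Fintype ι] {T : Digraph V}
    (hT : T.IsTournament) {u v : V} (huv : u ≠ v) {s e : ι → V}
    (hse : ∀ i, (s i = u ∧ e i = v) ∨ (s i = v ∧ e i = u)) {f : ι → List V}
    (hf : T.PathSystem u v s e f) (hint : ∀ i, ∃ w ∈ f i, w ≠ u ∧ w ≠ v)
    (hsp : ∀ w, ∃ i, w ∈ f i) :
    (∃ C, T.IsWeakSpanningContainer (Fintype.card ι) u v C) ∧
      ∃ C, T.IsWeakSpanningContainer (Fintype.card ι + 1) u v C := by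
  classical
  have hinj : Function.Injective f := by
    intro i j hij
    by_contra hne
    obtain ⟨w, hw, h1, h2⟩ := hint i
    exact (hf.disjoint i j hne w hw (hij ▸ hw)).elim h1 h2
  have hC : T.IsWeakSpanningContainer (Fintype.card ι) u v (Finset.univ.image f) := by
    refine ⟨by rw [Finset.card_image_of_injective _ hinj, Finset.card_univ], ?_, ?_, fun w => ?_⟩
    · simp only [Finset.mem_image, Finset.mem_univ, true_and, forall_exists_index,
        forall_apply_eq_imp_iff]
      intro i
      have := hf.path i
      rcases hse i with h | h <;> rw [h.1, h.2] at this
      exacts [Or.inl this, Or.inr this]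
    · simp only [Finset.mem_image, Finset.mem_univ, true_and, forall_exists_index,
        forall_apply_eq_imp_iff]
      exact fun i j hij => hf.disjoint i j (fun h => hij (h ▸ rfl))
    · obtain ⟨i, hi⟩ := hsp w
      exact ⟨f i, by simp, hi⟩
  refine ⟨⟨_, hC⟩, ?_⟩
  -- The additional path is the arc joining `u` and `v`; lacking internal vertices, it differs from
  -- every `f i`.
  obtain ⟨p, hp, hmem⟩ : ∃ p, (T.IsPath u v p ∨ T.IsPath v u p) ∧ ∀ x ∈ p, x = u ∨ x = v := by
    rcases hT.existsArc u v huv with h | h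
    · exact ⟨[u, v], Or.inl ⟨by simpa using h, by simpa using huv, rfl, rfl⟩, by simp⟩
    · exact ⟨[v, u], Or.inr ⟨by simpa using h, by simpa using huv.symm, rfl, rfl⟩,
        by simp [or_comm]⟩
  have hpC : p ∉ Finset.univ.image f := by
    simp only [Finset.mem_image, Finset.mem_univ, true_and, not_exists]
    rintro i rfl
    obtain ⟨w, hw, h1, h2⟩ := hint i
    exact (hmem w hw).elim h1 h2
  refine ⟨insert p (Finset.univ.image f), ?_, ?_, ?_, fun w => ?_⟩
  · rw [Finset.card_insert_of_notMem hpC, hC.card]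
  · intro q hq
    rcases Finset.mem_insert.1 hq with rfl | h
    · exact hp
    · exact hC.path q h
  · intro q hq r hr hne w hwq hwr
    rcases Finset.mem_insert.1 hq with rfl | hq
    · exact hmem w hwq
    · rcases Finset.mem_insert.1 hr with rfl | hr
      · exact hmem w hwr
      · exact hC.internallyDisjoint q hq r hr hne w hwq hwr
  · obtain ⟨q, hq, hw⟩ := hC.spanning w
    exact ⟨q, Finset.mem_insert_of_mem hq, hw⟩

/-! ### Disjoint cores. -/

/-- The interior of a path from `s` to `e` with one (if `p.1 = p.2`) or two internal vertices. -/
structure IsCore {V : Type*} (T : Digraph V) (s e : V) (p : V × V) : Prop where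
  fst : T.Adj s p.1
  snd : T.Adj p.2 e
  adj : p.1 = p.2 ∨ T.Adj p.1 p.2

theorem IsCore.ne {V : Type*} {T : Digraph V} (hT : T.IsTournament) {s e : V} {p : V × V}
    (h : T.IsCore s e p) : p.1 ≠ s ∧ p.1 ≠ e ∧ p.2 ≠ s ∧ p.2 ≠ e := by
  obtain ⟨a, b⟩ := p
  obtain ⟨h1, h2, h3⟩ := h
  dsimp only at *
  refine ⟨?_, ?_, ?_, ?_⟩ <;> rintro rfl
  · exact hT.irrefl _ h1
  · rcases h3 with rfl | h3
    · exact hT.irrefl _ h2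
    · exact hT.uniqueArc _ _ h2 h3
  · rcases h3 with rfl | h3
    · exact hT.irrefl _ h1
    · exact hT.uniqueArc _ _ h1 h3
  · exact hT.irrefl _ h2

theorem IsCore.exists_isPath {V : Type*} {T : Digraph V} (hT : T.IsTournament) {s e : V}
    {p : V × V} (hse : s ≠ e) (h : T.IsCore s e p) :
    ∃ q, T.IsPath s e q ∧ ∀ z, z ∈ q ↔ z = s ∨ z = p.1 ∨ z = p.2 ∨ z = e := by
  obtain ⟨n1, n2, n3, n4⟩ := h.ne hT
  obtain ⟨a, b⟩ := p
  obtain ⟨h1, h2, h3⟩ := h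
  dsimp only at *
  by_cases hab : a = b
  · subst hab
    refine ⟨[s, a, e], ⟨by simp [h1, h2], ?_, rfl, rfl⟩, fun z => ?_⟩
    · simp [n1.symm, hse, n2]
    · simp
  · refine ⟨[s, a, b, e], ⟨by simp [h1, h2, h3.resolve_left hab], ?_, rfl, rfl⟩, fun z => ?_⟩
    · simp [n1.symm, hse, n2, n3.symm, n4, hab]
    · simp

/-- A set of pairwise disjoint interiors of short paths between `u` and `v`. -/
structure IsCoreFamily {V : Type*} (T : Digraph V) (u v : V) (M : Finset (V × V)) : Prop where
  isCore : ∀ p ∈ M, T.IsCore u v p ∨ T.IsCore v u p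
  disjoint : ∀ p ∈ M, ∀ q ∈ M, p ≠ q → p.1 ≠ q.1 ∧ p.1 ≠ q.2 ∧ p.2 ≠ q.1 ∧ p.2 ≠ q.2

theorem IsCoreFamily.insert_core {V : Type*} [DecidableEq V] {T : Digraph V} {u v : V}
    {M : Finset (V × V)} (hM : T.IsCoreFamily u v M) {p : V × V}
    (hp : T.IsCore u v p ∨ T.IsCore v u p)
    (hpM : ∀ q ∈ M, p.1 ≠ q.1 ∧ p.1 ≠ q.2 ∧ p.2 ≠ q.1 ∧ p.2 ≠ q.2) :
    T.IsCoreFamily u v (insert p M) := by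
  refine ⟨fun q hq => ?_, fun q hq r hr hqr => ?_⟩
  · rcases Finset.mem_insert.1 hq with rfl | h
    · exact hp
    · exact hM.isCore q h
  · rcases Finset.mem_insert.1 hq with rfl | hq'
    · rcases Finset.mem_insert.1 hr with rfl | hr'
      · exact absurd rfl hqr
      · exact hpM r hr'
    · rcases Finset.mem_insert.1 hr with rfl | hr'
      · have := hpM q hq'
        exact ⟨this.1.symm, this.2.2.1.symm, this.2.1.symm, this.2.2.2.symm⟩
      · exact hM.disjoint q hq' r hr' hqr

open Finset Classical in
-- The arc obtained is a core in both directions. Outside `Z ∪ {u, v}` every vertex is dominated by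
-- both `u` and `v` (set `X`) or dominates both (set `Y`). Without an arc from `X` to `Y`,
-- closedness of `X` and of `Y` up to `Z` gives two bounds whose sum contradicts `h1`; `h2` keeps
-- both sets nonempty.
theorem IsTournament.exists_arc_of_card_lt {V : Type*} [Fintype V] {T : Digraph V}
    (hT : T.IsTournament) {k : ℕ} (hk : T.irregularity ≤ k) {u v : V} (huv : u ≠ v)
    {Z : Finset V} (hu : u ∉ Z) (hv : v ∉ Z)
    (hZ : ∀ x, (T.Adj u x ∧ T.Adj x v) ∨ (T.Adj v x ∧ T.Adj x u) → x ∈ Z)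
    (h1 : 3 * #Z + 2 * k ≤ Fintype.card V + 1) (h2 : 2 * #Z + k + 3 < Fintype.card V) :
    ∃ c d, c ∉ Z ∧ d ∉ Z ∧ T.Adj c d ∧ (T.Adj u c ∧ T.Adj v c) ∧ (T.Adj d u ∧ T.Adj d v) := by
  by_contra! hno
  set X : Finset V := {x | x ∉ Z ∧ T.Adj u x ∧ T.Adj v x} with hX
  set Y : Finset V := {x | x ∉ Z ∧ T.Adj x u ∧ T.Adj x v} with hY
  have hcov : ∀ x, x ≠ u → x ≠ v → x ∉ Z → x ∈ X ∨ x ∈ Y := by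
    intro x hxu hxv hxZ
    have h3 := hT.existsArc x u hxu
    have h4 := hT.existsArc x v hxv
    have h5 := mt (hZ x) hxZ
    simp only [hX, hY, mem_filter, mem_univ, true_and]
    tauto
  have hXY : Disjoint X Y := by
    rw [Finset.disjoint_left]
    intro x hx hy
    simp only [hX, hY, mem_filter] at hx hy
    exact hT.uniqueArc _ _ hx.2.2.1 hy.2.2.1
  have hXYZ : Disjoint (X ∪ Y) Z := by
    rw [Finset.disjoint_left]
    intro x hx
    simp only [hX, hY, mem_union, mem_filter] at hx
    exact hx.elim (·.2.1) (·.2.1)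
  have huvD : Disjoint (X ∪ Y ∪ Z) {u, v} := by
    rw [Finset.disjoint_right]
    intro x hx
    simp only [mem_insert, mem_singleton] at hx
    rcases hx with rfl | rfl <;> simp [hX, hY, hu, hv, hT.irrefl]
  have huniv : X ∪ Y ∪ Z ∪ {u, v} = univ := by
    ext x
    have := hcov x
    simp only [mem_union, mem_insert, mem_singleton, mem_univ, iff_true]
    tauto
  have hcard : #X + #Y + #Z + 2 = Fintype.card V := by
    rw [← card_univ, ← huniv, card_union_of_disjoint huvD, card_union_of_disjoint hXYZ,
      card_union_of_disjoint hXY, card_pair huv]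
  have hXle := T.card_le_outDeg_of_forall u X (by simp +contextual [hX])
  have hYle := T.card_le_inDeg_of_forall u Y (by simp +contextual [hY])
  have h3 := hT.outDeg_add_inDeg u
  have h4 := hT.card_le_inDeg hk u
  have h5 := hT.card_le_outDeg hk u
  have hXne : X.Nonempty := card_pos.1 (by omega)
  have hYne : Y.Nonempty := card_pos.1 (by omega)
  have h6 := hT.card_le_of_out_closed hk (Z := Z) hXne fun x hx y hxy => by
    by_contra! hy
    have hx' := hx
    simp only [hX, mem_filter, mem_univ, true_and] at hx'
    rcases hcov y (fun h => hT.uniqueArc _ _ hx'.2.1 (h ▸ hxy))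
      (fun h => hT.uniqueArc _ _ hx'.2.2 (h ▸ hxy)) hy.2 with h | h
    · exact hy.1 h
    · simp only [hY, mem_filter, mem_univ, true_and] at h
      exact hno x y hx'.1 h.1 hxy hx'.2 h.2.1 h.2.2
  have h7 := hT.card_le_of_in_closed hk (Z := Z) hYne fun x hx y hxy => by
    by_contra! hy
    have hx' := hx
    simp only [hY, mem_filter, mem_univ, true_and] at hx'
    rcases hcov y (fun h => hT.uniqueArc _ _ hx'.2.1 (h ▸ hxy))
      (fun h => hT.uniqueArc _ _ hx'.2.2 (h ▸ hxy)) hy.2 with h | h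
    · simp only [hX, mem_filter, mem_univ, true_and] at h
      exact hno y x h.1 hx'.1 hxy h.2 hx'.2.1 hx'.2.2
    · exact hy.1 h
  omega

open Finset Classical in
theorem IsCoreFamily.exists_insert {V : Type*} [Fintype V] {T : Digraph V}
    (hT : T.IsTournament) {k : ℕ} (hk : T.irregularity ≤ k) {u v : V} (huv : u ≠ v)
    {M : Finset (V × V)} (hM : T.IsCoreFamily u v M)
    (h1 : 6 * #M + 2 * k ≤ Fintype.card V + 1) (h2 : 4 * #M + k + 3 < Fintype.card V) :
    ∃ p, p ∉ M ∧ T.IsCoreFamily u v (insert p M) := by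
  set Z : Finset V := M.image Prod.fst ∪ M.image Prod.snd with hZ
  have hmem : ∀ p ∈ M, p.1 ∈ Z ∧ p.2 ∈ Z := fun p hp =>
    ⟨mem_union_left _ (mem_image_of_mem _ hp), mem_union_right _ (mem_image_of_mem _ hp)⟩
  have hins : ∀ p, T.IsCore u v p ∨ T.IsCore v u p → p.1 ∉ Z → p.2 ∉ Z →
      ∃ p, p ∉ M ∧ T.IsCoreFamily u v (insert p M) := fun p hp hp1 hp2 =>
    ⟨p, fun h => hp1 (hmem p h).1, hM.insert_core hp fun q hq =>
      ⟨fun h => hp1 (h ▸ (hmem q hq).1), fun h => hp1 (h ▸ (hmem q hq).2),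
        fun h => hp2 (h ▸ (hmem q hq).1), fun h => hp2 (h ▸ (hmem q hq).2)⟩⟩
  -- An unused middle vertex of a two-arc path is itself a core; only when all are used is a
  -- two-vertex core sought.
  by_cases hAB : ∀ x, (T.Adj u x ∧ T.Adj x v) ∨ (T.Adj v x ∧ T.Adj x u) → x ∈ Z
  · have hne : ∀ x ∈ Z, x ≠ u ∧ x ≠ v := by
      intro x hx
      simp only [hZ, mem_union, mem_image] at hx
      obtain ⟨p, hp, rfl⟩ | ⟨p, hp, rfl⟩ := hx
      · rcases hM.isCore p hp with h | h
        · exact ⟨(h.ne hT).1, (h.ne hT).2.1⟩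
        · exact ⟨(h.ne hT).2.1, (h.ne hT).1⟩
      · rcases hM.isCore p hp with h | h
        · exact ⟨(h.ne hT).2.2.1, (h.ne hT).2.2.2⟩
        · exact ⟨(h.ne hT).2.2.2, (h.ne hT).2.2.1⟩
    have hc : #Z ≤ #M + #M :=
      (card_union_le _ _).trans (Nat.add_le_add card_image_le card_image_le)
    obtain ⟨c, d, hc, hd, hcd, hc', hd'⟩ := hT.exists_arc_of_card_lt hk huv
      (fun h => (hne u h).1 rfl) (fun h => (hne v h).2 rfl) hAB (by omega) (by omega)
    exact hins (c, d) (Or.inl ⟨hc'.1, hd'.2, Or.inr hcd⟩) hc hd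
  · push Not at hAB
    obtain ⟨x, hx, hxZ⟩ := hAB
    exact hins (x, x) (hx.imp (fun h => ⟨h.1, h.2, Or.inl rfl⟩) fun h => ⟨h.1, h.2, Or.inl rfl⟩)
      hxZ hxZ

open Finset Classical in
-- All in-neighbours of `v` except possibly `u` also dominate `u`. The counted vertices are further
-- in-neighbours of `u`, so their number is at most `d⁻(u) - d⁻(v) + 1`, and in-degrees differ by at
-- most `k`.
theorem IsTournament.card_two_paths_le {V : Type*} [Fintype V] {T : Digraph V}
    (hT : T.IsTournament) {k : ℕ} (hk : T.irregularity ≤ k) {u v : V}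
    (h : ∀ x, ¬ (T.Adj u x ∧ T.Adj x v)) : #{x | T.Adj v x ∧ T.Adj x u} ≤ k + 1 := by
  have h1 := T.inDeg_le_card v (({x | T.Adj x v ∧ T.Adj x u} : Finset V) ∪ {u}) fun w hw => by
    by_cases hwu : w = u
    · simp [hwu]
    · have := hT.adj_of_not_adj (Ne.symm hwu) (fun h' => h w ⟨h', hw⟩)
      simp [hw, this]
  have h2 : Disjoint ({x | T.Adj v x ∧ T.Adj x u} : Finset V)
      ({x | T.Adj x v ∧ T.Adj x u} : Finset V) := by
    rw [Finset.disjoint_left]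
    intro x hx hx'
    simp only [mem_filter, mem_univ, true_and] at hx hx'
    exact hT.uniqueArc _ _ hx.1 hx'.1
  have h3 := T.card_le_inDeg_of_forall u
    (({x | T.Adj v x ∧ T.Adj x u} : Finset V) ∪
      ({x | T.Adj x v ∧ T.Adj x u} : Finset V)) fun w hw => by
      simp only [mem_union, mem_filter, mem_univ, true_and] at hw
      exact hw.elim (·.2) (·.2)
  rw [card_union_of_disjoint h2] at h3
  have h4 := card_union_le ({x | T.Adj x v ∧ T.Adj x u} : Finset V) {u}
  rw [card_singleton] at h4
  have h5 := hT.outDeg_add_inDeg u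
  have h6 := hT.card_le_outDeg hk u
  have h7 := hT.card_le_inDeg hk v
  omega

open Finset Classical in
theorem IsTournament.exists_isCoreFamily_card_two {V : Type*} [Fintype V] {T : Digraph V}
    (hT : T.IsTournament) {k : ℕ} (hk : T.irregularity ≤ k)
    (hn : 5 * k + 9 ≤ Fintype.card V) {u v : V} (huv : u ≠ v) :
    ∃ M, T.IsCoreFamily u v M ∧ #M = 2 ∧
      ∃ p ∈ M, ∃ q ∈ M, p ≠ q ∧ T.IsCore u v p ∧ T.IsCore v u q := by
  have hsingle : ∀ p, T.IsCore u v p ∨ T.IsCore v u p → T.IsCoreFamily u v {p} := fun p hp =>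
    ⟨by simpa using hp, fun q hq r hr hqr =>
      absurd ((mem_singleton.1 hq).trans (mem_singleton.1 hr).symm) hqr⟩
  by_cases hAB : (∃ x, T.Adj u x ∧ T.Adj x v) ∧ ∃ y, T.Adj v y ∧ T.Adj y u
  · obtain ⟨⟨x, hx⟩, y, hy⟩ := hAB
    have hxy : x ≠ y := fun h => hT.uniqueArc _ _ hx.1 (h ▸ hy.2)
    have hcx : T.IsCore u v (x, x) := ⟨hx.1, hx.2, Or.inl rfl⟩
    have hcy : T.IsCore v u (y, y) := ⟨hy.1, hy.2, Or.inl rfl⟩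
    have hne : (x, x) ≠ (y, y) := fun h => hxy (Prod.mk.inj h).1
    refine ⟨{(x, x), (y, y)}, (hsingle _ (Or.inr hcy)).insert_core (Or.inl hcx) ?_,
      card_pair hne, (x, x), by simp, (y, y), by simp, hne, hcx, hcy⟩
    simpa using hxy
  -- One direction has no two-arc path, so all middle vertices together number at most `k + 1`.
  -- Using them as `Z` is what costs `5 * k`, as `3 * (k + 1) + 2 * k`.
  · have hZ : #{x | (T.Adj u x ∧ T.Adj x v) ∨ (T.Adj v x ∧ T.Adj x u)} ≤ k + 1 := by
      by_cases hA : ∃ x, T.Adj u x ∧ T.Adj x v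
      · have hB : ∀ x, ¬ (T.Adj v x ∧ T.Adj x u) := fun x hx => hAB ⟨hA, x, hx⟩
        simpa only [hB, or_false] using hT.card_two_paths_le hk hB
      · push Not at hA
        have hA' : ∀ x, ¬ (T.Adj u x ∧ T.Adj x v) := fun x hx => hA x hx.1 hx.2
        simpa only [hA', false_or] using hT.card_two_paths_le hk hA'
    obtain ⟨c, d, -, -, hcd, hc, hd⟩ := hT.exists_arc_of_card_lt hk huv
      (Z := {x | (T.Adj u x ∧ T.Adj x v) ∨ (T.Adj v x ∧ T.Adj x u)})
      (by simp [hT.irrefl]) (by simp [hT.irrefl]) (by simp) (by omega) (by omega)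
    have h1 : T.IsCore u v (c, d) := ⟨hc.1, hd.2, Or.inr hcd⟩
    have h2 : T.IsCore v u (c, d) := ⟨hc.2, hd.1, Or.inr hcd⟩
    obtain ⟨p, hp, hM⟩ := (hsingle _ (Or.inl h1)).exists_insert hT hk huv
      (by rw [card_singleton]; omega) (by rw [card_singleton]; omega)
    have hp' : p ≠ (c, d) := by simpa using hp
    refine ⟨_, hM, by rw [card_insert_of_notMem hp, card_singleton], ?_⟩
    -- Whichever direction `p` has, `(c, d)` takes the other one.
    rcases hM.isCore p (mem_insert_self _ _) with h | h
    · exact ⟨p, by simp, (c, d), by simp, hp', h, h2⟩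
    · exact ⟨(c, d), by simp, p, by simp, hp'.symm, h1, h⟩

open Finset Classical in
theorem IsTournament.exists_isCoreFamily {V : Type*} [Fintype V] {T : Digraph V}
    (hT : T.IsTournament) {k : ℕ} (hk : T.irregularity ≤ k) {m : ℕ} (hm : 2 ≤ m)
    (hn : 6 * m + 5 * k ≤ Fintype.card V + 3) {u v : V} (huv : u ≠ v) :
    ∃ M, T.IsCoreFamily u v M ∧ #M = m ∧
      ∃ p ∈ M, ∃ q ∈ M, p ≠ q ∧ T.IsCore u v p ∧ T.IsCore v u q := by
  induction m, hm using Nat.le_induction with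
  | base => exact hT.exists_isCoreFamily_card_two hk (by omega) huv
  | succ m hm ih =>
    obtain ⟨M, hM, hcard, p, hp, q, hq, hpq, h1, h2⟩ := ih (by omega)
    obtain ⟨r, hr, hrM⟩ := hM.exists_insert hT hk huv (by omega) (by omega)
    exact ⟨_, hrM, by rw [card_insert_of_notMem hr, hcard], p, mem_insert_of_mem hp, q,
      mem_insert_of_mem hq, hpq, h1, h2⟩

theorem IsTournament.exists_containers {V : Type*} [Fintype V] {T : Digraph V}
    (hT : T.IsTournament) {k : ℕ} (hk : T.irregularity ≤ k) {m : ℕ} (hm : 2 ≤ m)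
    (hn : 6 * m + 5 * k ≤ Fintype.card V + 3) {u v : V} (huv : u ≠ v) :
    (∃ C, T.IsWeakSpanningContainer m u v C) ∧
      ∃ C, T.IsWeakSpanningContainer (m + 1) u v C := by
  classical
  obtain ⟨M, hM, hcard, p, hp, q, hq, hpq, h1, h2⟩ := hT.exists_isCoreFamily hk hm hn huv
  have hends : ∀ r : M, ∃ se : V × V, ((se.1 = u ∧ se.2 = v) ∨ (se.1 = v ∧ se.2 = u)) ∧
      T.IsCore se.1 se.2 r ∧ (r = ⟨p, hp⟩ → se = (u, v)) ∧ (r = ⟨q, hq⟩ → se = (v, u)) := by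
    intro r
    by_cases hrp : r = ⟨p, hp⟩
    · subst hrp
      exact ⟨(u, v), Or.inl ⟨rfl, rfl⟩, h1, fun _ => rfl, fun h => absurd (Subtype.mk.inj h) hpq⟩
    · by_cases hrq : r = ⟨q, hq⟩
      · subst hrq
        exact ⟨(v, u), Or.inr ⟨rfl, rfl⟩, h2, fun h => absurd h hrp, fun _ => rfl⟩
      · rcases hM.isCore r r.2 with h | h
        · exact ⟨(u, v), Or.inl ⟨rfl, rfl⟩, h, fun h => absurd h hrp, fun h => absurd h hrq⟩
        · exact ⟨(v, u), Or.inr ⟨rfl, rfl⟩, h, fun h => absurd h hrp, fun h => absurd h hrq⟩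
  choose se hse hcore hsep hseq using hends
  have hne : ∀ r, (se r).1 ≠ (se r).2 := by
    intro r
    rcases hse r with h | h <;> rw [h.1, h.2]
    exacts [huv, huv.symm]
  choose f hf hmem using fun r => (hcore r).exists_isPath hT (hne r)
  have hsys : T.PathSystem u v (fun r => (se r).1) (fun r => (se r).2) f := by
    refine ⟨hf, fun r r' hrr' w hw hw' => ?_⟩
    rw [hmem] at hw hw'
    have hd := hM.disjoint r r.2 r' r'.2 (fun h => hrr' (Subtype.ext h))
    have a1 := hse r
    have a2 := hse r'
    grind
  obtain ⟨g, hg, hfg, hsp⟩ := hsys.exists_spanning hT hk (by omega) huv hse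
    (i₀ := ⟨p, hp⟩) (i₁ := ⟨q, hq⟩) (by simp [hsep]) (by simp [hseq])
  have hint : ∀ r, ∃ w ∈ g r, w ≠ u ∧ w ≠ v := by
    intro r
    refine ⟨r.1.1, hfg r _ ((hmem r _).2 (by simp)), ?_⟩
    have h3 := (hcore r).ne hT
    rcases hse r with h | h <;> rw [h.1, h.2] at h3
    exacts [⟨h3.1, h3.2.1⟩, ⟨h3.2.1, h3.1⟩]
  have := hg.exists_containers hT huv hse hint hsp
  rwa [Fintype.card_coe, hcard] at this

end Digraph

/-! ### Hamiltonian cycles: rotation and Camion's theorem. -/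

namespace List

theorem IsChain.rotate_cons {α : Type*} {R : α → α → Prop} {x y : α} {l₁ l₂ : List α}
    (h : IsChain R (x :: (l₁ ++ y :: l₂) ++ [x])) : IsChain R (y :: (l₂ ++ x :: l₁) ++ [y]) := by
  have h' : IsChain R ((x :: l₁) ++ y :: (l₂ ++ [x])) := by simpa using h
  rw [isChain_split] at h'
  have h2 : IsChain R ((y :: l₂) ++ x :: (l₁ ++ [y])) := by
    rw [isChain_split]
    exact ⟨by simpa using h'.2, by simpa using h'.1⟩
  simpa using h2

theorem IsChain.exists_rotate {α : Type*} {R : α → α → Prop} {x a : α} {l : List α}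
    (h : IsChain R (x :: l ++ [x])) (ha : a ∈ x :: l) :
    ∃ l', IsChain R (a :: l' ++ [a]) ∧ (a :: l').Perm (x :: l) := by
  rcases mem_cons.1 ha with rfl | ha
  · exact ⟨l, h, Perm.refl _⟩
  · obtain ⟨l₁, l₂, rfl⟩ := append_of_mem ha
    refine ⟨l₂ ++ x :: l₁, h.rotate_cons, ?_⟩
    have := perm_append_comm (l₁ := a :: l₂) (l₂ := x :: l₁)
    simpa using this

theorem IsChain.forall_of_mem_of_cyclic {α : Type*} {R : α → α → Prop} {P : α → Prop} {x a b : α}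
    {l : List α} (h : IsChain R (x :: l ++ [x])) (hP : ∀ a b, R a b → P a → P b)
    (ha : a ∈ x :: l) (hPa : P a) (hb : b ∈ x :: l) : P b := by
  obtain ⟨l', h', hp⟩ := h.exists_rotate ha
  exact IsChain.induction P (a :: l' ++ [a]) h' (fun _ _ hxy hx => hP _ _ hxy hx) (by simpa using hPa)
    b (mem_append_left _ (hp.mem_iff.2 hb))

end List

namespace Digraph

open Finset Classical in
-- A vertex off the cycle with both an in- and an out-neighbour on it can be inserted. Otherwise
-- each vertex off the cycle dominates all of it or is dominated by all of it, and `hcut` supplies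
-- an arc `r → s` from the dominated kind to the dominating kind, to be inserted as a pair. The case
-- `l = []` treats a single vertex as a degenerate cycle.
theorem IsTournament.exists_longer_cycle {V : Type*} {T : Digraph V}
    (hT : T.IsTournament) {W : Finset V}
    (hcut : ∀ X ⊆ W, X.Nonempty → X ≠ W → ∃ x ∈ X, ∃ y ∈ W, y ∉ X ∧ T.Adj x y)
    {x : V} {l : List V} (hnd : (x :: l).Nodup) (hc : l = [] ∨ (x :: l ++ [x]).IsChain T.Adj)
    (hlW : ∀ z ∈ x :: l, z ∈ W) (hne : ∃ w ∈ W, w ∉ x :: l) :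
    ∃ a l', (a :: l').Nodup ∧ (a :: l' ++ [a]).IsChain T.Adj ∧ (∀ z ∈ a :: l', z ∈ W) ∧
      (x :: l).length < (a :: l').length := by
  by_cases hins : ∃ w ∈ W, w ∉ x :: l ∧ (∃ a ∈ x :: l, T.Adj a w) ∧ ∃ b ∈ x :: l, T.Adj w b
  · obtain ⟨w, hwW, hw, ⟨a, ha, haw⟩, b, hb, hwb⟩ := hins
    have hab : a ≠ b := fun h => hT.uniqueArc _ _ haw (h ▸ hwb)
    replace hc : (x :: l ++ [x]).IsChain T.Adj := by
      refine hc.resolve_left ?_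
      rintro rfl
      simp only [List.mem_singleton] at ha hb
      exact hab (ha.trans hb.symm)
    obtain ⟨l', hc', hp⟩ := hc.exists_rotate ha
    have hb' : b ∈ l' := (List.mem_cons.1 (hp.mem_iff.2 hb)).resolve_left hab.symm
    obtain ⟨l₁, p, q, l₂, h, hpw, hqw⟩ :=
      List.exists_split_of_head (P := fun z => T.Adj z w) haw hb' (hT.uniqueArc _ _ hwb)
    have hwl : w ∉ a :: l' := fun h => hw (hp.mem_iff.1 h)
    have hwq : T.Adj w q := by
      refine hT.adj_of_not_adj ?_ hqw
      rintro rfl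
      exact hwl (by simp [h])
    have hperm : (l₁ ++ p :: w :: q :: l₂).Perm (w :: a :: l') := by
      rw [h]
      have := List.perm_middle (a := w) (l₁ := l₁ ++ [p]) (l₂ := q :: l₂)
      simpa using this
    have hchain : (l₁ ++ p :: w :: q :: l₂ ++ [a]).IsChain T.Adj := by
      have h1 : (l₁ ++ p :: q :: (l₂ ++ [a])).IsChain T.Adj := by
        rw [h] at hc'
        simpa using hc'
      simpa using h1.insert hpw hwq
    obtain ⟨l'', hl''⟩ : ∃ l'', l₁ ++ p :: w :: q :: l₂ = a :: l'' := by
      cases l₁ with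
      | nil => exact ⟨w :: q :: l₂, by simp only [List.nil_append, List.cons.injEq] at h ⊢; simp [h.1]⟩
      | cons c l₁ =>
        simp only [List.cons_append, List.cons.injEq] at h
        exact ⟨l₁ ++ p :: w :: q :: l₂, by simp [h.1]⟩
    rw [hl''] at hperm hchain
    refine ⟨a, l'', ?_, hchain, fun z hz => ?_, ?_⟩
    · rw [hperm.nodup_iff, List.nodup_cons, hp.nodup_iff]
      exact ⟨hwl, hnd⟩
    · rcases List.mem_cons.1 (hperm.mem_iff.1 hz) with rfl | hz
      · exact hwW
      · exact hlW z (hp.mem_iff.1 hz)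
    · have h1 := hp.length_eq
      have h2 := hperm.length_eq
      simp only [List.length_cons] at h1 h2 ⊢
      omega
  · push Not at hins
    have hxW : x ∈ W := hlW x (by simp)
    have hout : ∃ s ∈ W, s ∉ x :: l ∧ T.Adj s x := by
      by_contra! hno
      obtain ⟨w, hw⟩ := hne
      obtain ⟨a, ha, y, hy, hya, hadj⟩ := hcut {w ∈ W | w ∉ x :: l} (filter_subset _ _)
        ⟨w, mem_filter.2 hw⟩ (fun h => (mem_filter.1 (h.symm ▸ hxW : x ∈ {w ∈ W | w ∉ x :: l})).2 (by simp))
      simp only [mem_filter, not_and, not_not] at ha hya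
      exact hins a ha.1 ha.2 ⟨x, by simp, hT.adj_of_not_adj (fun h => ha.2 (by simp [h]))
        (hno a ha.1 ha.2)⟩ y (hya hy) hadj
    obtain ⟨s₀, hs₀⟩ := hout
    obtain ⟨r, hr, s, hs, hsr, hrs⟩ := hcut {w ∈ W | ¬ (w ∉ x :: l ∧ T.Adj w x)}
      (filter_subset _ _) ⟨x, mem_filter.2 ⟨hxW, by simp⟩⟩
      (fun h => (mem_filter.1 (h.symm ▸ hs₀.1 :
        s₀ ∈ {w ∈ W | ¬ (w ∉ x :: l ∧ T.Adj w x)})).2 hs₀.2)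
    simp only [mem_filter] at hr
    replace hsr : s ∉ x :: l ∧ T.Adj s x := by
      by_contra h
      exact hsr (mem_filter.2 ⟨hs, h⟩)
    have hrl : r ∉ x :: l := fun h => hins s hs hsr.1 ⟨r, h, hrs⟩ x (by simp) hsr.2
    have hxr : T.Adj x r :=
      hT.adj_of_not_adj (fun h => hrl (by simp [h])) fun h => hr.2 ⟨hrl, h⟩
    have hsall : ∀ z ∈ x :: l, T.Adj s z := fun z hz =>
      hT.adj_of_not_adj (fun h => hsr.1 (h ▸ hz)) fun h =>
        hins s hs hsr.1 ⟨z, hz, h⟩ x (by simp) hsr.2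
    have hne' : r ≠ s := fun h => hT.irrefl r (by rwa [← h] at hrs)
    refine ⟨x, r :: s :: l, ?_, ?_, ?_, by simp⟩
    · have hsl := hsr.1
      simp only [List.nodup_cons, List.mem_cons, not_or] at *
      exact ⟨⟨Ne.symm hrl.1, Ne.symm hsl.1, hnd.1⟩, ⟨hne', hrl.2⟩, hsl.2, hnd.2⟩
    · cases l with
      | nil => simp [hxr, hrs, hsr.2]
      | cons b l =>
        have hc' := hc.resolve_left (by simp)
        simp only [List.cons_append, List.isChain_cons_cons] at hc' ⊢
        exact ⟨hxr, hrs, hsall b (by simp), hc'.2⟩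
    · intro z hz
      simp only [List.mem_cons] at hz
      rcases hz with rfl | rfl | rfl | hz
      exacts [hxW, hr.1, hs, hlW z (by simp [hz])]

open Finset Classical in
/-- Camion's theorem for a set of vertices of a tournament: if no proper part of it is closed
under domination, it carries a Hamiltonian cycle. -/
theorem IsTournament.exists_hamiltonian_cycle {V : Type*} {T : Digraph V}
    (hT : T.IsTournament) {W : Finset V} (hW : 2 ≤ #W)
    (hcut : ∀ X ⊆ W, X.Nonempty → X ≠ W → ∃ x ∈ X, ∃ y ∈ W, y ∉ X ∧ T.Adj x y) :
    ∃ x l, (x :: l).Nodup ∧ (x :: l ++ [x]).IsChain T.Adj ∧ ∀ z, z ∈ x :: l ↔ z ∈ W := by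
  have hlen : ∀ j, j + 1 ≤ #W → ∃ x l, (x :: l).Nodup ∧
      (l = [] ∨ (x :: l ++ [x]).IsChain T.Adj) ∧ (∀ z ∈ x :: l, z ∈ W) ∧
      j + 1 ≤ (x :: l).length := by
    intro j
    induction j with
    | zero =>
      intro _
      obtain ⟨x, hx⟩ : W.Nonempty := card_pos.1 (by omega)
      exact ⟨x, [], by simp, Or.inl rfl, by simpa using hx, by simp⟩
    | succ j ih =>
      intro hj
      obtain ⟨x, l, hnd, hc, hlW, hl⟩ := ih (by omega)
      rcases hl.lt_or_eq with hl | hl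
      · exact ⟨x, l, hnd, hc, hlW, hl⟩
      · have hne : ∃ w ∈ W, w ∉ x :: l := by
          by_contra! hall
          have h1 := card_le_card (s := W) (t := (x :: l).toFinset) fun w hw =>
            List.mem_toFinset.2 (hall w hw)
          rw [List.toFinset_card_of_nodup hnd] at h1
          omega
        obtain ⟨a, l', hnd', hc', hlW', hl'⟩ := hT.exists_longer_cycle hcut hnd hc hlW hne
        exact ⟨a, l', hnd', Or.inr hc', hlW', by omega⟩
  obtain ⟨x, l, hnd, hc, hlW, hl⟩ := hlen (#W - 1) (by omega)
  have hsub : (x :: l).toFinset ⊆ W := fun z hz => hlW z (List.mem_toFinset.1 hz)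
  have heq := eq_of_subset_of_card_le hsub (by rw [List.toFinset_card_of_nodup hnd]; omega)
  refine ⟨x, l, hnd, hc.resolve_left ?_, fun z => by rw [← heq, List.mem_toFinset]⟩
  rintro rfl
  simp only [List.length_singleton] at hl
  omega

open Finset Classical in
theorem IsTournament.exists_hamiltonian_cycle_sdiff_pair {V : Type*} [Fintype V] {T : Digraph V}
    (hT : T.IsTournament) {k : ℕ} (hk : T.irregularity ≤ k) (hn : 2 * k + 7 ≤ Fintype.card V)
    {u v : V} (huv : u ≠ v) :
    ∃ x l, (x :: l).Nodup ∧ (x :: l ++ [x]).IsChain T.Adj ∧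
      ∀ z, z ∈ x :: l ↔ z ≠ u ∧ z ≠ v := by
  have hcard : #(univ \ {u, v} : Finset V) + 2 = Fintype.card V := by
    rw [← card_pair huv, card_sdiff_add_card_eq_card (subset_univ _), card_univ]
  suffices hcut : ∀ X ⊆ (univ \ {u, v} : Finset V), X.Nonempty → X ≠ univ \ {u, v} →
      ∃ x ∈ X, ∃ y ∈ univ \ {u, v}, y ∉ X ∧ T.Adj x y by
    obtain ⟨x, l, hnd, hc, hmem⟩ := hT.exists_hamiltonian_cycle (by omega) hcut
    exact ⟨x, l, hnd, hc, fun z => by rw [hmem]; simp⟩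
  intro X hXW hX hne
  by_contra! hno
  have h1 := hT.card_le_of_out_closed hk (Z := {u, v}) hX fun x hx y hxy => by
    by_contra! h
    exact hno x hx y (mem_sdiff.2 ⟨mem_univ _, h.2⟩) h.1 hxy
  -- The complement of an out-closed set is in-closed. The two bounds add up to `2n ≤ (n - 2) + 8 +
  -- 2k`, against `2 * k + 7 ≤ n`.
  have hY : ((univ \ {u, v}) \ X).Nonempty :=
    sdiff_nonempty.2 fun h => hne (Subset.antisymm hXW h)
  have h2 := hT.card_le_of_in_closed hk (Z := {u, v}) hY fun y hy x hxy => by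
    by_contra! h
    rw [mem_sdiff] at hy
    by_cases hx : x ∈ X
    · exact hno x hx y hy.1 hy.2 hxy
    · exact h.1 (mem_sdiff.2 ⟨mem_sdiff.2 ⟨mem_univ _, h.2⟩, hx⟩)
  have h3 := card_sdiff_add_card_eq_card hXW
  rw [card_pair huv] at h1 h2
  omega

/-! ### Spanning paths between two vertices. -/

theorem isPath_of_interior {V : Type*} {T : Digraph V} {s e a b : V} {q : List V}
    (hse : s ≠ e) (hnd : q.Nodup) (hc : q.IsChain T.Adj) (hq : ∀ z ∈ q, z ≠ s ∧ z ≠ e)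
    (ha : q.head? = some a) (hb : q.getLast? = some b) (hsa : T.Adj s a) (hbe : T.Adj b e) :
    T.IsPath s e (s :: q ++ [e]) := by
  refine ⟨?_, ?_, by simp, by rw [List.getLast?_concat]⟩
  · rw [List.isChain_append, List.isChain_cons]
    refine ⟨⟨by simp [ha, hsa], hc⟩, by simp, ?_⟩
    have : q ≠ [] := by rintro rfl; simp at ha
    obtain ⟨c, q, rfl⟩ := List.exists_cons_of_ne_nil this
    rw [List.getLast?_cons_cons, hb]
    simpa using hbe
  · rw [List.nodup_append, List.nodup_cons]
    refine ⟨⟨fun h => (hq s h).1 rfl, hnd⟩, by simp, ?_⟩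
    intro x hx y hy
    rw [List.mem_singleton] at hy
    subst hy
    rcases List.mem_cons.1 hx with rfl | h
    · exact hse
    · exact (hq x h).2

/-- In a Hamiltonian cycle `x, l` of `T - {s, e}`, if there is no spanning `(e, s)`-path and the
rest of the cycle is the interior of an `(e, s)`-path, then `x` dominates the first three vertices
of `l`. -/
theorem IsTournament.adj_of_no_spanning_path {V : Type*} [Fintype V] {T : Digraph V}
    (hT : T.IsTournament) {k : ℕ} (hk : T.irregularity ≤ k) (hn : k + 8 ≤ Fintype.card V)
    {s e x z : V} {pre suf : List V} (hnd : (x :: (pre ++ z :: suf)).Nodup)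
    (hmem : ∀ w, w ∈ x :: (pre ++ z :: suf) ↔ w ≠ s ∧ w ≠ e) (hpre : pre.length ≤ 2)
    (hsx : T.Adj s x) (hp : T.IsPath e s (e :: (pre ++ z :: suf) ++ [s]))
    (hno : ∀ p, T.IsPath e s p → ∃ w, w ∉ p) : T.Adj x z := by
  classical
  have hxne := (hmem x).1 (by simp)
  have hxl := (List.nodup_cons.1 hnd).1
  have hxp : x ∉ e :: (pre ++ z :: suf) ++ [s] := by
    intro h
    simp only [List.cons_append, List.mem_cons, List.mem_append, List.mem_nil_iff] at h hxl
    have := hxne.1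
    have := hxne.2
    tauto
  refine hT.adj_of_not_adj (fun h => hxl (by simp [h])) fun hzx => ?_
  -- If `z → x`, then `x` could be inserted between `z` and any out-neighbour in `suf`. So only `e`
  -- and the at most two vertices of `pre` can be out-neighbours of `x`, whence `n ≤ 2 * 3 + k + 1`.
  have hsuf : ∀ y ∈ suf, ¬ T.Adj x y := by
    intro y hy hxy
    obtain ⟨q, hq, hqm⟩ := hT.exists_insert (l := suf ++ [s]) hp hxp
      ⟨e :: pre, by simp⟩ hzx (List.mem_append_left _ hy) hxy
    obtain ⟨w, hw⟩ := hno q hq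
    rw [hqm] at hw
    have h1 := hmem w
    simp only [List.cons_append, List.mem_cons, List.mem_append, List.mem_nil_iff] at hw h1
    tauto
  have h1 := T.outDeg_le_card x (insert e pre.toFinset) fun w hw => by
    rw [Finset.mem_insert, List.mem_toFinset]
    by_contra! hwn
    have hws : w ≠ s := fun h => hT.uniqueArc _ _ hsx (h ▸ hw)
    have h2 := (hmem w).2 ⟨hws, hwn.1⟩
    simp only [List.mem_cons, List.mem_append] at h2
    rcases h2 with rfl | h2 | rfl | h2
    · exact hT.irrefl _ hw
    · exact hwn.2 h2
    · exact hT.uniqueArc _ _ hzx hw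
    · exact hsuf w h2 hw
  have h2 := Finset.card_insert_le e pre.toFinset
  have h3 := pre.toFinset_card_le
  have h4 := hT.card_le_outDeg hk x
  omega

/-- Opening the cycle at an arc `a → b` leaves a path from `b` to `a`; no spanning path means that
neither `u → b, a → v` nor `v → b, a → u` holds. This rules out vertices related alike to `u` and
`v`, and makes the two remaining types alternate. -/
theorem IsTournament.alternating_of_no_spanning_path {V : Type*} [Fintype V] {T : Digraph V}
    (hT : T.IsTournament) {k : ℕ} (hk : T.irregularity ≤ k) (hn : k + 4 ≤ Fintype.card V)
    {u v : V} (huv : u ≠ v) {x : V} {l : List V} (hnd : (x :: l).Nodup)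
    (hc : (x :: l ++ [x]).IsChain T.Adj) (hmem : ∀ z, z ∈ x :: l ↔ z ≠ u ∧ z ≠ v)
    (huno : ∀ p, T.IsPath u v p → ∃ w, w ∉ p) (hvno : ∀ p, T.IsPath v u p → ∃ w, w ∉ p) :
    (∀ z ∈ x :: l, (T.Adj u z ∧ T.Adj z v) ∨ (T.Adj v z ∧ T.Adj z u)) ∧
    (x :: l ++ [x]).IsChain fun a b => T.Adj a b ∧
      (T.Adj u a → T.Adj a v → T.Adj v b ∧ T.Adj b u) ∧
      (T.Adj v a → T.Adj a u → T.Adj u b ∧ T.Adj b v) := by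
  have key : ∀ (q : List V) (a b : V), q.Perm (x :: l) → q.IsChain T.Adj → q.head? = some b →
      q.getLast? = some a → ¬ (T.Adj u b ∧ T.Adj a v) ∧ ¬ (T.Adj v b ∧ T.Adj a u) := by
    intro q a b hq hqc hb ha
    have hqm : ∀ z, z ∈ q ↔ z ≠ u ∧ z ≠ v := fun z => hq.mem_iff.trans (hmem z)
    have hqn := hq.nodup_iff.2 hnd
    constructor
    · rintro ⟨h1, h2⟩
      obtain ⟨w, hw⟩ := huno _ (isPath_of_interior huv hqn hqc (fun z => (hqm z).1) hb ha h1 h2)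
      have := hqm w
      simp only [List.cons_append, List.mem_cons, List.mem_append, List.mem_nil_iff] at hw
      tauto
    · rintro ⟨h1, h2⟩
      obtain ⟨w, hw⟩ := hvno _ (isPath_of_interior huv.symm hqn hqc
        (fun z hz => ((hqm z).1 hz).symm) hb ha h1 h2)
      have := hqm w
      simp only [List.cons_append, List.mem_cons, List.mem_append, List.mem_nil_iff] at hw
      tauto
  have hR : (x :: l ++ [x]).IsChain fun a b => T.Adj a b ∧ a ∈ x :: l ∧ b ∈ x :: l ∧
      ¬ (T.Adj u b ∧ T.Adj a v) ∧ ¬ (T.Adj v b ∧ T.Adj a u) := by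
    rw [List.isChain_iff_forall_rel_of_append_cons_cons]
    intro a b l₁ l₂ h
    rw [List.isChain_iff_forall_rel_of_append_cons_cons] at hc
    refine ⟨hc h, ?_⟩
    rw [← List.isChain_iff_forall_rel_of_append_cons_cons] at hc
    -- An empty `l₂` is the closing arc back to `x`; any other arc requires rotating the cycle.
    rcases List.eq_nil_or_concat l₂ with rfl | ⟨l₂, c, rfl⟩
    · have h' : (x :: l) ++ [x] = (l₁ ++ [a]) ++ [b] := by simpa using h
      obtain ⟨h1, h2⟩ := List.append_inj' h' rfl
      obtain rfl : x = b := by simpa using h2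
      refine ⟨h1 ▸ by simp, by simp, key (x :: l) a x (List.Perm.refl _) ?_ rfl ?_⟩
      · exact (List.isChain_append.1 hc).1
      · rw [h1, List.getLast?_concat]
    · have h' : (x :: l) ++ [x] = (l₁ ++ a :: b :: l₂) ++ [c] := by simpa using h
      obtain ⟨h1, h2⟩ := List.append_inj' h' rfl
      obtain rfl : x = c := by simpa using h2
      obtain ⟨k₁, hk₁⟩ : ∃ k₁, l₁ ++ [a] = x :: k₁ := by
        cases l₁ with
        | nil =>
          simp only [List.nil_append, List.cons.injEq] at h1
          exact ⟨[], by simp [h1.1]⟩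
        | cons d l₁ =>
          simp only [List.cons_append, List.cons.injEq] at h1
          exact ⟨l₁ ++ [a], by simp [h1.1]⟩
      have hl : l = k₁ ++ b :: l₂ := by
        have : x :: l = (l₁ ++ [a]) ++ b :: l₂ := by simpa using h1
        rw [hk₁] at this
        simpa using this
      subst hl
      refine ⟨?_, by simp, key (b :: l₂ ++ x :: k₁) a b ?_ ?_ rfl ?_⟩
      · have : a ∈ x :: k₁ := hk₁ ▸ by simp
        exact List.mem_append_left (b :: l₂) this
      · exact List.perm_append_comm
      · have := hc.rotate_cons
        exact (List.isChain_append.1 this).1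
      · rw [← hk₁, ← List.append_assoc, List.getLast?_concat]
  have hdom : ∀ {a w : V}, a ∈ x :: l → (w = u ∨ w = v) → ¬ T.Adj a w → T.Adj w a := by
    intro a w ha hw h
    have := (hmem a).1 ha
    refine hT.adj_of_not_adj ?_ h
    rcases hw with rfl | rfl
    exacts [this.1, this.2]
  have hdom' : ∀ {a w : V}, a ∈ x :: l → (w = u ∨ w = v) → ¬ T.Adj w a → T.Adj a w := by
    intro a w ha hw h
    have := (hmem a).1 ha
    refine hT.adj_of_not_adj ?_ h
    rcases hw with rfl | rfl
    exacts [this.1.symm, this.2.symm]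
  have hD : ∀ d ∈ x :: l, ¬ (T.Adj d u ∧ T.Adj d v) := by
    intro d hd hdD
    -- Dominating both `u` and `v` passes to the next vertex of the cycle, hence to all, leaving `u`
    -- with out-degree at most one.
    have hall : ∀ z ∈ x :: l, T.Adj z u ∧ T.Adj z v := fun z hz =>
      hR.forall_of_mem_of_cyclic (P := fun z => T.Adj z u ∧ T.Adj z v)
        (fun a b hab ha => ⟨hdom' hab.2.2.1 (Or.inl rfl) fun h => hab.2.2.2.1 ⟨h, ha.2⟩,
          hdom' hab.2.2.1 (Or.inr rfl) fun h => hab.2.2.2.2 ⟨h, ha.1⟩⟩) hd hdD hz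
    have h1 := T.outDeg_le_card u {v} fun w hw => by
      by_contra! hwv
      rw [Finset.mem_singleton] at hwv
      have hwu : w ≠ u := fun h => hT.irrefl u (by rwa [h] at hw)
      exact hT.uniqueArc _ _ hw (hall w ((hmem w).2 ⟨hwu, hwv⟩)).1
    have h2 := hT.card_le_outDeg hk u
    rw [Finset.card_singleton] at h1
    omega
  have hC : ∀ c ∈ x :: l, ¬ (T.Adj u c ∧ T.Adj v c) := by
    intro c hc' hcC
    have hall : ∀ z ∈ x :: l, T.Adj u z ∧ T.Adj v z := by
      intro z hz
      by_contra hz'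
      -- Being dominated by both passes backwards, so its negation is propagated forwards.
      refine hR.forall_of_mem_of_cyclic (P := fun z => ¬ (T.Adj u z ∧ T.Adj v z))
        (fun a b hab ha hb => ha ?_) hz hz' hc' hcC
      exact ⟨hdom hab.2.1 (Or.inl rfl) fun h => hab.2.2.2.2 ⟨hb.2, h⟩,
        hdom hab.2.1 (Or.inr rfl) fun h => hab.2.2.2.1 ⟨hb.1, h⟩⟩
    have h1 := T.inDeg_le_card u {v} fun w hw => by
      by_contra! hwv
      rw [Finset.mem_singleton] at hwv
      have hwu : w ≠ u := fun h => hT.irrefl u (by rwa [h] at hw)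
      exact hT.uniqueArc _ _ hw (hall w ((hmem w).2 ⟨hwu, hwv⟩)).1
    have h2 := hT.card_le_inDeg hk u
    rw [Finset.card_singleton] at h1
    omega
  constructor
  · intro z hz
    have h1 := hC z hz
    have h2 := hD z hz
    have h3 := @hdom z u hz (Or.inl rfl)
    have h4 := @hdom z v hz (Or.inr rfl)
    tauto
  · refine hR.imp fun a b hab => ⟨hab.1, fun h1 h2 => ?_, fun h1 h2 => ?_⟩
    · have h3 : ¬ T.Adj u b := fun h => hab.2.2.2.1 ⟨h, h2⟩
      have h4 := hdom' hab.2.2.1 (Or.inl rfl) h3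
      exact ⟨hdom hab.2.2.1 (Or.inr rfl) fun h => hD b hab.2.2.1 ⟨h4, h⟩, h4⟩
    · have h3 : ¬ T.Adj v b := fun h => hab.2.2.2.2 ⟨h, h2⟩
      have h4 := hdom' hab.2.2.1 (Or.inr rfl) h3
      exact ⟨hdom hab.2.2.1 (Or.inl rfl) fun h => hD b hab.2.2.1 ⟨h, h4⟩, h4⟩

/-- On the cycle `x, x₁, x₂, x₃, …, b, y`, alternation gives `x`, `x₂`, `b` the type `u → z → v` and
`x₁`, `y` the opposite type. The chords `x → x₃` and `y → x₁` are forced, so `u, x, x₃, …, b, y, x₁,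
x₂, v` is a spanning path. -/
theorem IsTournament.false_of_no_spanning_path {V : Type*} [Fintype V] {T : Digraph V}
    (hT : T.IsTournament) {k : ℕ} (hk : T.irregularity ≤ k) (hn : k + 8 ≤ Fintype.card V)
    {u v : V} (huv : u ≠ v) {x : V} {l : List V} (hnd : (x :: l).Nodup)
    (hc : (x :: l ++ [x]).IsChain T.Adj) (hmem : ∀ z, z ∈ x :: l ↔ z ≠ u ∧ z ≠ v)
    (huno : ∀ p, T.IsPath u v p → ∃ w, w ∉ p) (hvno : ∀ p, T.IsPath v u p → ∃ w, w ∉ p)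
    (hux : T.Adj u x) (hxv : T.Adj x v) : False := by
  classical
  obtain ⟨hAB, hR⟩ := hT.alternating_of_no_spanning_path hk (by omega) huv hnd hc hmem huno hvno
  have hlen : 5 ≤ l.length := by
    have h1 : (Finset.univ : Finset V) ⊆ (x :: l).toFinset ∪ {u, v} := fun z _ => by
      have := hmem z
      rw [Finset.mem_union, List.mem_toFinset, Finset.mem_insert, Finset.mem_singleton]
      tauto
    have h2 := (Finset.card_le_card h1).trans (Finset.card_union_le _ _)
    rw [Finset.card_univ, List.toFinset_card_of_nodup hnd, Finset.card_pair huv,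
      List.length_cons] at h2
    omega
  obtain ⟨x₁, x₂, x₃, mid, b, y, rfl⟩ :
      ∃ x₁ x₂ x₃ mid b y, l = x₁ :: x₂ :: x₃ :: (mid ++ [b, y]) := by
    clear hR hAB hmem hc hnd
    obtain ⟨x₁, x₂, x₃, l', rfl⟩ : ∃ x₁ x₂ x₃ l', l = x₁ :: x₂ :: x₃ :: l' := by
      match l, hlen with
      | x₁ :: x₂ :: x₃ :: l', _ => exact ⟨x₁, x₂, x₃, l', rfl⟩
    simp only [List.length_cons] at hlen
    rcases List.eq_nil_or_concat l' with rfl | ⟨l', y, rfl⟩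
    · simp at hlen
    · rcases List.eq_nil_or_concat l' with rfl | ⟨mid, b, rfl⟩
      · simp at hlen
      · exact ⟨x₁, x₂, x₃, mid, b, y, by simp⟩
  have hR' := hR
  simp only [List.cons_append, List.isChain_cons_cons, List.append_assoc] at hR'
  obtain ⟨⟨-, hx₁, -⟩, ⟨h₁₂, -, hx₂⟩, -, hR'⟩ := hR'
  rw [← List.cons_append, List.isChain_append] at hR'
  have hR₂ := hR'.2.1
  simp only [List.nil_append, List.isChain_cons_cons] at hR₂
  obtain ⟨⟨-, hbA, hbB⟩, ⟨-, hyA, -⟩, -⟩ := hR₂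
  have hvx₁ := hx₁ hux hxv
  have hux₂ := hx₂ hvx₁.1 hvx₁.2
  have hy : T.Adj v y ∧ T.Adj y u := (hAB y (by simp)).resolve_left fun h =>
    hT.uniqueArc _ _ hux (hyA h.1 h.2).2
  have hb : T.Adj u b ∧ T.Adj b v := (hAB b (by simp)).resolve_right fun h =>
    hT.uniqueArc _ _ hy.2 (hbB h.1 h.2).1
  have hc₀ := (List.isChain_append.1 hc).1
  have hne : ∀ z ∈ x :: x₁ :: x₂ :: x₃ :: (mid ++ [b, y]), z ≠ u ∧ z ≠ v := fun z => (hmem z).1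
  have hxx₃ : T.Adj x x₃ := by
    refine hT.adj_of_no_spanning_path hk hn (pre := [x₁, x₂]) (suf := mid ++ [b, y]) hnd hmem
      (by simp) hux ?_ hvno
    exact isPath_of_interior (a := x₁) (b := y) huv.symm (List.nodup_cons.1 hnd).2
      (List.isChain_cons.1 hc₀).2 (fun z hz => (hne z (List.mem_cons_of_mem _ hz)).symm) rfl
      (by simp [List.getLast?_cons]) hvx₁.1 hy.2
  have hperm : (y :: x :: x₁ :: x₂ :: x₃ :: (mid ++ [b])).Perm
      (x :: x₁ :: x₂ :: x₃ :: (mid ++ [b, y])) := by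
    have := List.perm_append_comm (l₁ := [y]) (l₂ := x :: x₁ :: x₂ :: x₃ :: (mid ++ [b]))
    simpa using this
  have hnd' := hperm.nodup_iff.2 hnd
  have hyx₁ : T.Adj y x₁ := by
    refine hT.adj_of_no_spanning_path hk hn (s := v) (e := u) (pre := [x])
      (suf := x₂ :: x₃ :: (mid ++ [b])) hnd'
      (fun z => hperm.mem_iff.trans ((hmem z).trans and_comm)) (by simp) hy.1 ?_ huno
    refine isPath_of_interior (a := x) (b := b) huv (List.nodup_cons.1 hnd').2 ?_
      (fun z hz => hne z (hperm.mem_iff.1 (List.mem_cons_of_mem _ hz))) rfl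
      (by simp [List.getLast?_cons]) hux hb.2
    have h1 : ((x :: x₁ :: x₂ :: x₃ :: (mid ++ [b])) ++ [y]).IsChain T.Adj := by simpa using hc₀
    exact (List.isChain_append.1 h1).1
  have hperm' : (x :: x₃ :: (mid ++ [b, y, x₁, x₂])).Perm
      (x :: x₁ :: x₂ :: x₃ :: (mid ++ [b, y])) := by
    have := List.perm_append_comm (l₁ := x₃ :: (mid ++ [b, y])) (l₂ := [x₁, x₂])
    simpa using this
  have hchain : (x :: x₃ :: (mid ++ [b, y, x₁, x₂])).IsChain T.Adj := by
    rw [List.isChain_cons_cons] at hc₀ ⊢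
    rw [List.isChain_cons_cons, List.isChain_cons_cons] at hc₀
    have h1 : ((x₃ :: (mid ++ [b])) ++ y :: [x₁, x₂]).IsChain T.Adj := by
      rw [List.isChain_split]
      refine ⟨by simpa using hc₀.2.2.2, ?_⟩
      simp [hyx₁, h₁₂]
    exact ⟨hxx₃, by simpa using h1⟩
  have hpath := isPath_of_interior (a := x) (b := x₂) huv (hperm'.nodup_iff.2 hnd) hchain
    (fun z hz => hne z (hperm'.mem_iff.1 hz)) rfl (by simp [List.getLast?_cons]) hux hux₂.2
  obtain ⟨w, hw⟩ := huno _ hpath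
  refine hw (List.mem_append.2 ?_)
  by_cases hwv : w = v
  · exact Or.inr (List.mem_singleton.2 hwv)
  · by_cases hwu : w = u
    · exact Or.inl (List.mem_cons.2 (Or.inl hwu))
    · exact Or.inl (List.mem_cons_of_mem _ (hperm'.mem_iff.2 ((hmem w).2 ⟨hwu, hwv⟩)))

/-- Weak Hamiltonian connectedness of tournaments of small irregularity. -/
theorem IsTournament.exists_spanning_path {V : Type*} [Fintype V] {T : Digraph V}
    (hT : T.IsTournament) {k : ℕ} (hk : T.irregularity ≤ k) (hn : 2 * k + 8 ≤ Fintype.card V)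
    {u v : V} (huv : u ≠ v) : ∃ p, (T.IsPath u v p ∨ T.IsPath v u p) ∧ ∀ w, w ∈ p := by
  by_contra! hno
  have huno : ∀ p, T.IsPath u v p → ∃ w, w ∉ p := fun p hp => hno p (Or.inl hp)
  have hvno : ∀ p, T.IsPath v u p → ∃ w, w ∉ p := fun p hp => hno p (Or.inr hp)
  obtain ⟨x, l, hnd, hc, hmem⟩ := hT.exists_hamiltonian_cycle_sdiff_pair hk (by omega) huv
  have hAB :=
    (hT.alternating_of_no_spanning_path hk (by omega) huv hnd hc hmem huno hvno).1 x (by simp)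
  rcases hAB with h | h
  · exact hT.false_of_no_spanning_path hk (by omega) huv hnd hc hmem huno hvno h.1 h.2
  · exact hT.false_of_no_spanning_path hk (by omega) huv.symm hnd hc
      (fun z => (hmem z).trans and_comm) hvno huno h.1 h.2

theorem IsTournament.exists_containers_one {V : Type*} [Fintype V] {T : Digraph V}
    (hT : T.IsTournament) {k : ℕ} (hk : T.irregularity ≤ k) (hn : 2 * k + 8 ≤ Fintype.card V)
    {u v : V} (huv : u ≠ v) :
    (∃ C, T.IsWeakSpanningContainer 1 u v C) ∧ ∃ C, T.IsWeakSpanningContainer 2 u v C := by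
  classical
  obtain ⟨p, hp, hsp⟩ := hT.exists_spanning_path hk hn huv
  obtain ⟨w, -, hw⟩ : ∃ w ∈ Finset.univ, w ∉ ({u, v} : Finset V) :=
    Finset.exists_mem_notMem_of_card_lt_card (by
      rw [Finset.card_pair huv, Finset.card_univ]; omega)
  simp only [Finset.mem_insert, Finset.mem_singleton, not_or] at hw
  obtain ⟨s, e, hse, hpath⟩ : ∃ s e, ((s = u ∧ e = v) ∨ (s = v ∧ e = u)) ∧ T.IsPath s e p := by
    rcases hp with hp | hp
    · exact ⟨u, v, Or.inl ⟨rfl, rfl⟩, hp⟩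
    · exact ⟨v, u, Or.inr ⟨rfl, rfl⟩, hp⟩
  have hsys : T.PathSystem u v (fun _ : Unit => s) (fun _ => e) (fun _ => p) :=
    ⟨fun _ => hpath, fun i j hij => absurd rfl hij⟩
  simpa using hsys.exists_containers hT huv (fun _ => hse) (fun _ => ⟨w, hsp w, hw⟩)
    fun x => ⟨(), hsp x⟩

end Digraph

theorem mainTheorem2 {V : Type*} [Fintype V] (T : Digraph V) (hT : T.IsTournament)
    (t k : ℕ) (ht : 2 ≤ t) (hk : T.irregularity ≤ k)
    (hn : 6 * (t : ℤ) + 5 * (k : ℤ) - 3 ≤ (Fintype.card V : ℤ)) :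
    t + 1 ≤ T.weakSpanningConnectivity := by
  have : Nontrivial V := Fintype.one_lt_card_iff_nontrivial.1 (by omega)
  refine le_csSup T.bddAbove_weaklySpanningConnected fun ω h1 hω u v huv => ?_
  have hone := hT.exists_containers_one hk (by omega) huv
  obtain rfl | rfl | h3 : ω = 1 ∨ ω = 2 ∨ 3 ≤ ω := by omega
  · exact hone.1
  · exact hone.2
  -- Only `m = ω - 1 ≤ t` cores are needed, since the arc between `u` and `v` is the remaining path.
  · obtain ⟨m, rfl⟩ : ∃ m, ω = m + 1 := ⟨ω - 1, by omega⟩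
    exact (hT.exists_containers hk (m := m) (by omega) (by omega) huv).2
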